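/- All topological spaces are Hausdorff and all vector spaces are over $\mathbb C$. A locally convex space $L_X$ is a free locally convex space of a topological space $X$ if $L_X$ contains $X$ as a topological subspace and every continuous map $f:X\to Y$ into a locally convex space $Y$ has a unique extension to a continuous linear operator $T:L_X\to Y$. Let $L_X^0\subseteq L_X$ be the subspace of all finite linear combinations $\sum_j c_jx_j$ of points $x_j\in X$ with $\sum_j c_j=0$. Proposition. Let $X$ be a regular countable topological space and let $L_X$ be a free locally convex space of $X$. Then $L_X$ and $L_X^0$ have at most countable algebraic dimension. Moreover, $L_X$ is complete if and only if $X$ has no non-trivial convergent sequences, and $L_X^0$ is complete if and only if $X$ has no non-trivial convergent sequences (a convergent sequence is trivial if it is eventually constant). -/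

import Mathlib

open Filter Topology

universe u v

/-- `E`, together with the map `ι : X → E`, is a free locally convex space of the topological
space `X`: the Hausdorff locally convex complex space `E` contains `X` (through `ι`) as a
topological subspace, and every continuous map from `X` to a Hausdorff locally convex complex
space `Y` extends to a unique continuous linear operator `E → Y`. -/
structure IsFreeLocallyConvexSpace {X E : Type u} [TopologicalSpace X]
    [AddCommGroup E] [Module ℂ E] [TopologicalSpace E] [IsTopologicalAddGroup E]
    [ContinuousSMul ℂ E] [LocallyConvexSpace ℝ E] [T2Space E] (ι : X → E) : Prop where
  isEmbedding : IsEmbedding ι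
  existsUnique_extension : ∀ (Y : Type u) [AddCommGroup Y] [Module ℂ Y] [TopologicalSpace Y]
    [IsTopologicalAddGroup Y] [ContinuousSMul ℂ Y] [LocallyConvexSpace ℝ Y] [T2Space Y]
    (f : X → Y), Continuous f → ∃! T : E →L[ℂ] Y, ∀ x, T (ι x) = f x

/-- The subspace of all finite combinations `∑ c_j ι(x_j)` of total mass `∑ c_j = 0`. -/
noncomputable def zeroMassSubspace {X E : Type u} [AddCommGroup E] [Module ℂ E] (ι : X → E) :
    Submodule ℂ E :=
  (LinearMap.ker (Finsupp.linearCombination ℂ (fun _ : X => (1 : ℂ)))).map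
    (Finsupp.linearCombination ℂ ι)

/-- `X` has no non-trivial convergent sequences: every convergent sequence is eventually
constant. -/
def NoNontrivialConvergentSeq (X : Type u) [TopologicalSpace X] : Prop :=
  ∀ (s : ℕ → X) (x : X), Tendsto s atTop (𝓝 x) → ∃ N, ∀ n ≥ N, s n = s N

/-! ### Existence of free locally convex spaces -/

/-- The locally convex vector space topologies on the finitely supported functions for which
`x ↦ δ_x` is continuous. -/
def freeTopologies (X : Type u) [TopologicalSpace X] : Set (TopologicalSpace (X →₀ ℂ)) :=
  {t | @IsTopologicalAddGroup _ t _ ∧ @ContinuousSMul ℂ _ _ _ t ∧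
    @LocallyConvexSpace ℝ _ _ _ _ _ t ∧
    @Continuous _ _ _ t (fun x : X => Finsupp.single x (1 : ℂ))}

/-- The linear extension of a continuous map is continuous for the finest of these topologies. -/
theorem continuous_linearCombination_sInf_freeTopologies (X : Type u) [TopologicalSpace X]
    (Y : Type v) [AddCommGroup Y] [Module ℂ Y] [tY : TopologicalSpace Y]
    [IsTopologicalAddGroup Y] [ContinuousSMul ℂ Y] [LocallyConvexSpace ℝ Y]
    (f : X → Y) (hf : Continuous f) :
    @Continuous _ _ (sInf (freeTopologies X)) _ (Finsupp.linearCombination ℂ f) := by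
  refine continuous_sInf_dom (t := tY.induced (Finsupp.linearCombination ℂ f)) ?_
    continuous_induced_dom
  refine ⟨topologicalAddGroup_induced _, continuousSMul_induced _,
    LocallyConvexSpace.induced ((Finsupp.linearCombination ℂ f).restrictScalars ℝ), ?_⟩
  refine continuous_induced_rng.2 ?_
  simpa [Function.comp_def] using hf

/-- A free locally convex space exists over each completely regular Hausdorff space. -/
theorem exists_isFreeLocallyConvexSpace (X : Type u) [TopologicalSpace X] [T35Space X] :
    ∃ (E : Type u) (_ : AddCommGroup E) (_ : Module ℂ E) (_ : UniformSpace E)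
      (_ : IsUniformAddGroup E) (_ : ContinuousSMul ℂ E) (_ : LocallyConvexSpace ℝ E)
      (_ : T2Space E) (ι : X → E), IsFreeLocallyConvexSpace ι := by
  let t : TopologicalSpace (X →₀ ℂ) := sInf (freeTopologies X)
  have h1 : IsTopologicalAddGroup (X →₀ ℂ) := topologicalAddGroup_sInf fun s hs => hs.1
  have h2 : ContinuousSMul ℂ (X →₀ ℂ) := continuousSMul_sInf fun s hs => hs.2.1
  have h3 : LocallyConvexSpace ℝ (X →₀ ℂ) := LocallyConvexSpace.sInf fun s hs => hs.2.2.1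
  have hδ : Continuous (fun x : X => Finsupp.single x (1 : ℂ)) :=
    continuous_sInf_rng.2 fun s hs => hs.2.2.2
  have key' : ∀ f : X → ℝ, Continuous f →
      Continuous (Finsupp.linearCombination ℂ (fun x => ((f x : ℝ) : ℂ))) :=
    fun f hf => continuous_linearCombination_sInf_freeTopologies X ℂ _
      (Complex.continuous_ofReal.comp hf)
  have hsep : ∀ (x : X) (K : Set X), IsClosed K → x ∉ K →
      ∃ f : X → ℝ, Continuous f ∧ f x = 1 ∧ ∀ y ∈ K, f y = 0 := by
    intro x K hK hx
    obtain ⟨f, hf, hfx, hfK⟩ := CompletelyRegularSpace.completely_regular x K hK hx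
    refine ⟨fun y => 1 - (f y : ℝ), by fun_prop, by simp [hfx], fun y hy => ?_⟩
    simp [hfK hy]
  have h4 : T2Space (X →₀ ℂ) := by
    refine T2Space.mk fun μ ν hne => ?_
    obtain ⟨x, hx⟩ := Finsupp.ne_iff.1 hne
    classical
    set F : Finset X := (μ.support ∪ ν.support).erase x
    obtain ⟨f, hf, hfx, hfF⟩ := hsep x F F.finite_toSet.isClosed (by simp [F])
    have hval : ∀ ρ : X →₀ ℂ, ρ.support ⊆ μ.support ∪ ν.support →
        Finsupp.linearCombination ℂ (fun x => ((f x : ℝ) : ℂ)) ρ = ρ x := by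
      intro ρ hρ
      rw [Finsupp.linearCombination_apply, Finsupp.sum, Finset.sum_eq_single x]
      · simp [hfx]
      · intro y hy hyx
        have : y ∈ F := Finset.mem_erase.2 ⟨hyx, hρ hy⟩
        simp [hfF y (by simpa using this)]
      · intro hxs
        simp [Finsupp.notMem_support_iff.1 hxs]
    refine separated_by_continuous (key' f hf) ?_
    rwa [hval μ Finset.subset_union_left, hval ν Finset.subset_union_right]
  let : UniformSpace (X →₀ ℂ) := IsTopologicalAddGroup.rightUniformSpace (X →₀ ℂ)
  have h5 : IsUniformAddGroup (X →₀ ℂ) := isUniformAddGroup_of_addCommGroup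
  refine ⟨X →₀ ℂ, inferInstance, inferInstance, inferInstance, h5, h2, h3, h4,
    fun x => Finsupp.single x 1, ⟨⟨?_, ?_⟩, ?_⟩⟩
  · refine isInducing_iff_nhds.2 fun x => le_antisymm (hδ.tendsto x).le_comap ?_
    intro U hU
    obtain ⟨V, hVU, hV, hxV⟩ := mem_nhds_iff.1 hU
    obtain ⟨f, hf, hfx, hfV⟩ := hsep x Vᶜ hV.isClosed_compl (by simpa using hxV)
    refine ⟨Finsupp.linearCombination ℂ (fun x => ((f x : ℝ) : ℂ)) ⁻¹' {0}ᶜ, ?_, ?_⟩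
    · refine (isOpen_compl_singleton.preimage (key' f hf)).mem_nhds ?_
      simp [hfx]
    · intro y hy
      by_contra hyU
      refine hy ?_
      simp [hfV y fun hyV => hyU (hVU hyV)]
  · exact Finsupp.single_left_injective one_ne_zero
  · intro Y _ _ _ _ _ _ _ f hf
    refine ⟨⟨Finsupp.linearCombination ℂ f, 
      continuous_linearCombination_sInf_freeTopologies X Y f hf⟩, fun x => by simp, fun T hT => ?_⟩
    refine ContinuousLinearMap.coe_injective (Finsupp.lhom_ext' fun x => ?_)
    ext
    simpa using hT x

/-! Completeness when only trivial sequences converge: a Cauchy filter on `E` has a limit under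
every continuous operator into a Banach space, so the limits along the lifts define a linear
functional `φ` on `C(X, ℂ)`. Applied to maps `X → ℓ¹`, this makes `φ` σ-additive over clopen
partitions. Then `φ` has compact support and depends only on values there. Compact sets are finite
under the hypothesis, so `φ` is a finite combination of point evaluations. Thus the filter converges
weakly to an element of `E`, and a weakly convergent Cauchy filter converges.

Conversely, if `s n → x` is non-trivial, the series `∑ 2⁻ᵏ (ι (s k) - ι x)` is Cauchy in the
zero-mass subspace. Its sum would be a finite combination of points, but a nonnegative function that
vanishes at these points and at `x` and equals `1` at some `s n` tells the two apart. The zero-mass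
subspace is closed, which closes the circle of implications. -/

/-! ### Countable regular spaces: clopen sets and compact sets -/

section CountableRegular

variable {X : Type u} [TopologicalSpace X] [T2Space X] [RegularSpace X] [Countable X]

instance lindelofSpace_of_countable : LindelofSpace X :=
  ⟨(Set.to_countable Set.univ).isLindelof⟩

/-- A regular Lindelöf space is normal, hence completely regular; a real function on a countable set
omits values in every interval, and cutting at an omitted value gives clopen sets. -/
theorem isTopologicalBasis_isClopen_of_countable :
    TopologicalSpace.IsTopologicalBasis {s : Set X | IsClopen s} :=
  CompletelyRegularSpace.isTopologicalBasis_clopens_of_cardinalMk_lt_continuum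
    ((Cardinal.mk_le_aleph0_iff.2 inferInstance).trans_lt Cardinal.aleph0_lt_continuum)

theorem exists_isClopen_subset {x : X} {U : Set X} (hU : U ∈ 𝓝 x) :
    ∃ W, IsClopen W ∧ x ∈ W ∧ W ⊆ U :=
  isTopologicalBasis_isClopen_of_countable.mem_nhds_iff.1 hU

/-- In a countable regular space, an infinite compact set contains a sequence converging to a
point different from all of its terms. -/
theorem exists_seq_tendsto_ne_of_infinite_isCompact {K : Set X} (hK : IsCompact K)
    (hinf : K.Infinite) : ∃ (s : ℕ → X) (x : X), Tendsto s atTop (𝓝 x) ∧ ∀ n, s n ≠ x := by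
  obtain ⟨x, -, hx⟩ := hinf.exists_accPt_of_subset_isCompact hK subset_rfl
  have hW : ∀ y : X, ∃ W : Set X, IsClopen W ∧ x ∈ W ∧ (y ≠ x → y ∉ W) := by
    intro y
    by_cases hy : y = x
    · exact ⟨Set.univ, isClopen_univ, trivial, fun h => (h hy).elim⟩
    · obtain ⟨W, h1, h2, h3⟩ := exists_isClopen_subset (isOpen_compl_singleton.mem_nhds
        (show x ∈ ({y} : Set X)ᶜ from fun h => hy h.symm))
      exact ⟨W, h1, h2, fun _ h => h3 h rfl⟩
  choose W hWc hxW hyW using hW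
  have : Nonempty X := ⟨x⟩
  obtain ⟨e, he⟩ := exists_surjective_nat X
  have hk : ∀ n : ℕ, ∃ k, (k ∈ ⋂ i ∈ Finset.range (n + 1), W (e i)) ∧ k ∈ K ∧ k ≠ x := by
    intro n
    have hN : (⋂ i ∈ Finset.range (n + 1), W (e i)) ∈ 𝓝 x :=
      (Finset.iInter_mem_sets _).2 fun i _ => (hWc (e i)).isOpen.mem_nhds (hxW _)
    obtain ⟨k, ⟨h1, h2⟩, h3⟩ := accPt_iff_nhds.1 hx _ hN
    exact ⟨k, h1, h2, h3⟩
  choose k hkW hkK hkx using hk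
  refine ⟨k, x, ?_, hkx⟩
  -- A cluster point `z = e i` other than `x` would lie in the closed set `W (e i)`, which contains
  -- `k n` for all `n ≥ i` but not `z`.
  refine hK.tendsto_nhds_of_unique_mapClusterPt (Eventually.of_forall hkK) fun z _ hz => ?_
  by_contra hzx
  obtain ⟨i, rfl⟩ := he z
  refine hyW (e i) hzx ?_
  refine (hWc (e i)).isClosed.mem_of_frequently_of_tendsto ?_ tendsto_id
  refine (mapClusterPt_iff_frequently.1 hz |> fun h => ?_)
  by_contra hcon
  rw [Filter.not_frequently] at hcon
  obtain ⟨n, hn1, hn2⟩ := ((h _ hcon).and_eventually (eventually_ge_atTop i)).exists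
  refine hn1 ?_
  have := hkW n
  simp only [Set.mem_iInter, Finset.mem_range] at this
  exact this i (by omega)

theorem IsCompact.finite_of_noNontrivialConvergentSeq (hX : NoNontrivialConvergentSeq X)
    {K : Set X} (hK : IsCompact K) : K.Finite := by
  by_contra hinf
  obtain ⟨s, x, hs, hne⟩ := exists_seq_tendsto_ne_of_infinite_isCompact hK hinf
  obtain ⟨N, hN⟩ := hX s x hs
  refine hne N (tendsto_nhds_unique (tendsto_const_nhds.congr' ?_) hs)
  filter_upwards [eventually_ge_atTop N] with n hn using (hN n hn).symm

theorem exists_continuousMap_eq_one_eq_zero {K : Set X} (hK : IsClosed K) {x : X} (hx : x ∉ K) :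
    ∃ f : C(X, ℂ), f x = 1 ∧ (∀ y ∈ K, f y = 0) ∧ ∀ y, 0 ≤ (f y).re := by
  classical
  obtain ⟨W, hW, hxW, hWK⟩ := exists_isClopen_subset (hK.isOpen_compl.mem_nhds hx)
  refine ⟨⟨W.indicator fun _ => 1, continuous_const.indicator (by simp [hW.frontier_eq])⟩,
    by simp [hxW], fun y hy => ?_, fun y => ?_⟩
  · have : y ∉ W := fun h => hWK h hy
    simp [this]
  · by_cases hy : y ∈ W <;> simp [hy]

end CountableRegular

/-! ### σ-additive functionals on `C(X, ℂ)` and their supports -/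

section Functional

variable {X : Type u} [TopologicalSpace X]

/-- A functional on `C(X, ℂ)` which is additive along every decomposition of a continuous function
into pieces supported on the fibres of a map `ν : X → ℕ` that is locally constant off the zero
set of the function. -/
def IsSigmaAdditive (φ : C(X, ℂ) →ₗ[ℂ] ℂ) : Prop :=
  ∀ (ν : X → ℕ) (f : C(X, ℂ)) (g : ℕ → C(X, ℂ)), (∀ x, f x ≠ 0 → ∀ᶠ y in 𝓝 x, ν y = ν x) →
    (∀ n x, g n x = if ν x = n then f x else 0) → HasSum (fun n => φ (g n)) (φ f)

/-- The index `ν` may jump only where `f` vanishes, and there the norm of the value, `‖f y‖`, tends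
to zero. -/
theorem continuous_lpSingle {ν : X → ℕ} {f : X → ℂ} (hf : Continuous f)
    (hν : ∀ x, f x ≠ 0 → ∀ᶠ y in 𝓝 x, ν y = ν x) :
    Continuous (fun x => (lp.single 1 (ν x) (f x) : lp (fun _ : ℕ => ℂ) 1)) := by
  refine continuous_iff_continuousAt.2 fun x => ?_
  by_cases hx : f x = 0
  · rw [ContinuousAt, hx, lp.single_zero, tendsto_zero_iff_norm_tendsto_zero]
    have : Tendsto (fun y => ‖f y‖) (𝓝 x) (𝓝 0) := by
      simpa [hx] using (hf.tendsto x).norm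
    refine this.congr fun y => ?_
    rw [lp.norm_single one_pos]
  · have h := (((lp.isometry_single (E := fun _ : ℕ => ℂ) (p := 1) (ν x)).continuous.comp
      hf).continuousAt (x := x))
    refine h.congr ?_
    filter_upwards [hν x hx] with y hy
    simp [hy]

theorem continuous_ite_fiber {ν : X → ℕ} {f : X → ℂ} (hf : Continuous f)
    (hν : ∀ x, f x ≠ 0 → ∀ᶠ y in 𝓝 x, ν y = ν x) (n : ℕ) :
    Continuous (fun x => if ν x = n then f x else 0) := by
  refine ((lp.evalCLM ℂ (fun _ : ℕ => ℂ) 1 n).continuous.comp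
    (continuous_lpSingle hf hν)).congr fun x => ?_
  by_cases h : ν x = n
  · subst h
    simp [lp.evalCLM]
  · simp [lp.evalCLM, h, Ne.symm h]

/-- A functional on `C(X, ℂ)` is `σ`-additive if it behaves like a point evaluation on
compositions of a continuous map to `ℓ¹` with continuous functionals. -/
theorem isSigmaAdditive_of_forall_lp {φ : C(X, ℂ) →ₗ[ℂ] ℂ}
    (h : ∀ G : C(X, lp (fun _ : ℕ => ℂ) 1), ∃ y : lp (fun _ : ℕ => ℂ) 1,
      ∀ l : lp (fun _ : ℕ => ℂ) 1 →L[ℂ] ℂ, φ ((l : C(lp (fun _ : ℕ => ℂ) 1, ℂ)).comp G) = l y) :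
    IsSigmaAdditive φ := by
  intro ν f g hν hg
  -- The coordinates of this map are the `g n`, and the sum of its coordinates is `f`.
  obtain ⟨y, hy⟩ := h ⟨_, continuous_lpSingle f.continuous hν⟩
  have hsum := (lp.hasSum_single (by simp) y).mapL (lp.tsumCLM ℂ ℕ ℂ)
  have h1 : ∀ (n : ℕ) (c : ℂ), lp.tsumCLM ℂ ℕ ℂ (lp.single 1 n c) = c := by
    intro n c
    simp [lp.tsumCLM, Pi.single_apply]
  simp only [h1] at hsum
  have hg' : ∀ n, φ (g n) = y n := fun n => by
    rw [show y n = lp.evalCLM ℂ (fun _ : ℕ => ℂ) 1 n y from rfl, ← hy]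
    congr 1
    ext x
    by_cases h : ν x = n
    · subst h
      simp [hg, lp.evalCLM]
    · simp [hg, lp.evalCLM, h, Ne.symm h]
  have hf : φ f = lp.tsumCLM ℂ ℕ ℂ y := by
    rw [← hy]
    congr 1
    ext x
    exact (h1 _ _).symm
  simpa only [hg', hf] using! hsum

/-- The support of a functional on `C(X, ℂ)`: the points all of whose clopen neighbourhoods carry
a function on which the functional does not vanish. -/
def functionalSupport (φ : C(X, ℂ) →ₗ[ℂ] ℂ) : Set X :=
  {x | ∀ W : Set X, IsClopen W → x ∈ W → ∃ f : C(X, ℂ), (∀ y ∉ W, f y = 0) ∧ φ f ≠ 0}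

theorem isClosed_functionalSupport (φ : C(X, ℂ) →ₗ[ℂ] ℂ) : IsClosed (functionalSupport φ) := by
  refine isOpen_compl_iff.1 (isOpen_iff_mem_nhds.2 fun x hx => ?_)
  simp only [functionalSupport, Set.mem_compl_iff, Set.mem_ofPred_eq, not_forall] at hx
  obtain ⟨W, hW, hxW, h⟩ := hx
  exact mem_of_superset (hW.isOpen.mem_nhds hxW) fun y hy hyK => h (hyK W hW hy)

/-- Used to make countable clopen covers disjoint: being in the first set containing `x` and outside
the finitely many earlier ones is an open condition. -/
theorem eventually_find_eq {U : ℕ → Set X} (hU : ∀ n, IsClopen (U n)) {x : X} {n : ℕ}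
    (hx : x ∈ U n) : ∀ᶠ y in 𝓝 x, sInf {n | y ∈ U n} = sInf {n | x ∈ U n} := by
  have hmem : x ∈ U (sInf {n | x ∈ U n}) := Nat.sInf_mem (s := {n | x ∈ U n}) ⟨n, hx⟩
  have h1 : ∀ᶠ y in 𝓝 x, y ∈ U (sInf {n | x ∈ U n}) := (hU _).isOpen.mem_nhds hmem
  have h2 : ∀ᶠ y in 𝓝 x, ∀ m ∈ Finset.range (sInf {n | x ∈ U n}), y ∉ U m := by
    refine (Finset.eventually_all _).2 fun m hm => ?_
    exact (hU m).compl.isOpen.mem_nhds fun h => Nat.notMem_of_lt_sInf (Finset.mem_range.1 hm) h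
  filter_upwards [h1, h2] with y hy1 hy2
  refine le_antisymm (Nat.sInf_le hy1) (le_of_not_gt fun hlt => ?_)
  exact hy2 _ (Finset.mem_range.2 hlt) (Nat.sInf_mem (s := {n | y ∈ U n}) ⟨_, hy1⟩)

/-- Countably many clopen sets on which `φ` is null cover the complement of the support. Made
disjoint, they cut `f` into pieces killed by `φ`. -/
theorem IsSigmaAdditive.eq_zero_of_eqOn_functionalSupport [Countable X] {φ : C(X, ℂ) →ₗ[ℂ] ℂ}
    (hφ : IsSigmaAdditive φ) {f : C(X, ℂ)} (hf : ∀ x ∈ functionalSupport φ, f x = 0) :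
    φ f = 0 := by
  have hW : ∀ x : X, ∃ W : Set X, IsClopen W ∧ (x ∉ functionalSupport φ → x ∈ W) ∧
      ∀ g : C(X, ℂ), (∀ y ∉ W, g y = 0) → φ g = 0 := by
    intro x
    by_cases hx : x ∈ functionalSupport φ
    · refine ⟨∅, isClopen_empty, fun h => (h hx).elim, fun g hg => ?_⟩
      rw [show g = 0 from ContinuousMap.ext fun y => hg y (by simp), map_zero]
    · simp only [functionalSupport, Set.mem_ofPred_eq, not_forall, not_exists, not_and,
        not_not] at hx
      obtain ⟨W, h1, h2, h3⟩ := hx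
      exact ⟨W, h1, fun _ => h2, h3⟩
  choose W hWc hxW hW0 using hW
  rcases isEmpty_or_nonempty X with hX | hX
  · rw [show f = 0 from ContinuousMap.ext fun y => (hX.false y).elim, map_zero]
  obtain ⟨e, he⟩ := exists_surjective_nat X
  set ν : X → ℕ := fun x => sInf {n | x ∈ W (e n)} with hνdef
  have hcov : ∀ x, f x ≠ 0 → ∃ n, x ∈ W (e n) := by
    intro x hx
    obtain ⟨n, rfl⟩ := he x
    exact ⟨n, hxW _ fun h => hx (hf _ h)⟩
  have hν : ∀ x, f x ≠ 0 → ∀ᶠ y in 𝓝 x, ν y = ν x := fun x hx => by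
    obtain ⟨n, hn⟩ := hcov x hx
    exact eventually_find_eq (fun n => hWc (e n)) hn
  have hsum := hφ ν f (fun n => ⟨_, continuous_ite_fiber f.continuous hν n⟩) hν fun n x => rfl
  refine hsum.unique ?_
  convert hasSum_zero (α := ℂ) (β := ℕ) using 2 with n
  refine hW0 (e n) _ fun y hy => ?_
  by_cases hfy : f y = 0
  · simp [hfy]
  · have : ν y ≠ n := by
      rintro rfl
      exact hy (Nat.sInf_mem (s := {n | y ∈ W (e n)}) (hcov y hfy))
    simp [this]

variable [T2Space X] [RegularSpace X] [Countable X]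

/-- A filter without cluster points yields a countable clopen partition of `X`. Only finitely many
pieces can carry `φ`, so finitely many sets with complement in the filter cover the support. -/
theorem IsSigmaAdditive.isCompact_functionalSupport {φ : C(X, ℂ) →ₗ[ℂ] ℂ}
    (hφ : IsSigmaAdditive φ) : IsCompact (functionalSupport φ) := by
  intro F hF hFK
  by_contra hcon
  push Not at hcon
  have hW : ∀ x : X, ∃ W : Set X, IsClopen W ∧ x ∈ W ∧ Wᶜ ∈ F := by
    intro x
    have hx : ¬ ClusterPt x F := fun h =>
      hcon x ((isClosed_iff_clusterPt.1 (isClosed_functionalSupport φ)) x (h.mono hFK)) h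
    rw [ClusterPt, not_neBot, ← disjoint_iff, Filter.disjoint_iff] at hx
    obtain ⟨U, hU, V, hV, hUV⟩ := hx
    obtain ⟨W, h1, h2, h3⟩ := exists_isClopen_subset hU
    exact ⟨W, h1, h2, mem_of_superset hV fun y hy hyW => Set.disjoint_left.1 hUV (h3 hyW) hy⟩
  choose W hWc hxW hWF using hW
  obtain ⟨x₀, -⟩ := hF.nonempty_of_mem (univ_mem : Set.univ ∈ F)
  have : Nonempty X := ⟨x₀⟩
  obtain ⟨e, he⟩ := exists_surjective_nat X
  set U : ℕ → Set X := fun n => W (e n) with hU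
  have hUc : ∀ n, IsClopen (U n) := fun n => hWc (e n)
  have hcov : ∀ x, ∃ n, x ∈ U n := fun x => by
    obtain ⟨n, rfl⟩ := he x
    exact ⟨n, hxW _⟩
  set ν : X → ℕ := fun x => sInf {n | x ∈ U n} with hνdef
  have hνU : ∀ x, x ∈ U (ν x) := fun x => Nat.sInf_mem (s := {n | x ∈ U n}) (hcov x)
  have hν : ∀ x, ∀ᶠ y in 𝓝 x, ν y = ν x := fun x => eventually_find_eq hUc (hνU x)
  have hνc : ∀ n, IsClopen {x | ν x = n} := fun n =>
    (isClopen_discrete {n}).preimage (continuous_discrete_rng.2 fun b =>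
      isOpen_iff_mem_nhds.2 fun x hx => by
        filter_upwards [hν x] with y hy
        exact hy.trans hx)
  have hfin : ∃ N, ∀ n ≥ N, ∀ f : C(X, ℂ), (∀ y, ν y ≠ n → f y = 0) → φ f = 0 := by
    by_contra hne
    push Not at hne
    -- Normalised to `φ (g n) = 1` on each piece carrying `φ`; infinitely many such terms contradict
    -- summability for the glued function.
    have hg : ∀ n : ℕ, ∃ g : C(X, ℂ), (∀ y, ν y ≠ n → g y = 0) ∧
        ((∃ f : C(X, ℂ), (∀ y, ν y ≠ n → f y = 0) ∧ φ f ≠ 0) → φ g = 1) := by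
      intro n
      by_cases h : ∃ f : C(X, ℂ), (∀ y, ν y ≠ n → f y = 0) ∧ φ f ≠ 0
      · obtain ⟨f, hf, hφf⟩ := h
        exact ⟨(φ f)⁻¹ • f, fun y hy => by simp [hf y hy], fun _ => by simp [hφf]⟩
      · exact ⟨0, by simp, fun h' => (h h').elim⟩
    choose g hg0 hg1 using hg
    have hcont : Continuous fun x => g (ν x) x := by
      refine continuous_iff_continuousAt.2 fun x => ?_
      refine ((g (ν x)).continuous.continuousAt (x := x)).congr ?_
      filter_upwards [hν x] with y hy
      rw [hy]
    have hsum := hφ ν ⟨_, hcont⟩ g (fun x _ => hν x) fun n x => by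
      by_cases h : ν x = n
      · subst h
        simp
      · simp [h, hg0 n x h]
    have hlim := hsum.summable.tendsto_atTop_zero
    obtain ⟨N, hN⟩ := (hlim.eventually (isOpen_compl_singleton.mem_nhds
      (show (0 : ℂ) ∈ ({1} : Set ℂ)ᶜ by simp))).exists_forall_of_atTop
    obtain ⟨n, hn, hf⟩ := hne N
    exact hN n hn (hg1 n hf)
  obtain ⟨N, hN⟩ := hfin
  have hKU : functionalSupport φ ⊆ ⋃ n ∈ Finset.range N, U n := by
    intro x hx
    have hlt : ν x < N := by
      by_contra hge
      obtain ⟨f, hf, hφf⟩ := hx {y | ν y = ν x} (hνc _) rfl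
      exact hφf (hN _ (not_lt.1 hge) f hf)
    exact Set.mem_biUnion (Finset.mem_coe.2 (Finset.mem_range.2 hlt)) (hνU x)
  have hcompl : (⋂ n ∈ Finset.range N, (U n)ᶜ) ∈ F :=
    (Finset.iInter_mem_sets _).2 fun n _ => hWF (e n)
  obtain ⟨z, hz1, hz2⟩ := hF.nonempty_of_mem (inter_mem hcompl (hFK (mem_principal_self _)))
  obtain ⟨n, hn, hzn⟩ := Set.mem_iUnion₂.1 (hKU hz2)
  exact Set.mem_iInter₂.1 hz1 n hn hzn

/-- Over a countable regular space without non-trivial convergent sequences, `σ`-additive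
functionals are finite combinations of point evaluations. -/
theorem IsSigmaAdditive.exists_finset_sum {φ : C(X, ℂ) →ₗ[ℂ] ℂ} (hφ : IsSigmaAdditive φ)
    (hX : NoNontrivialConvergentSeq X) :
    ∃ (s : Finset X) (c : X → ℂ), ∀ f : C(X, ℂ), φ f = ∑ x ∈ s, c x * f x := by
  classical
  have hK := hφ.isCompact_functionalSupport.finite_of_noNontrivialConvergentSeq hX
  have hh : ∀ x : X, ∃ f : C(X, ℂ), f x = 1 ∧ ∀ y ∈ functionalSupport φ \ {x}, f y = 0 := fun x =>
    let ⟨f, h1, h2, _⟩ := exists_continuousMap_eq_one_eq_zero (x := x)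
      (hK.subset Set.sdiff_subset : (functionalSupport φ \ {x}).Finite).isClosed (by simp)
    ⟨f, h1, h2⟩
  choose h h1 h0 using hh
  refine ⟨hK.toFinset, fun x => φ (h x), fun f => ?_⟩
  have key := hφ.eq_zero_of_eqOn_functionalSupport (f := f - ∑ x ∈ hK.toFinset, f x • h x) ?_
  · rw [map_sub, sub_eq_zero, map_sum] at key
    simp [key, mul_comm]
  · intro y hy
    rw [ContinuousMap.sub_apply, ContinuousMap.sum_apply, Finset.sum_eq_single y]
    · simp [h1]
    · intro x _ hxy
      simp [h0 x y ⟨hy, Ne.symm hxy⟩]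
    · intro hy'
      simp [hy] at hy'

end Functional

/-! ### Cauchy filters and series in locally convex spaces -/

section LocallyConvex

/-- In a locally convex space, a Cauchy filter that converges weakly converges. -/
theorem Cauchy.le_nhds_of_forall_tendsto {E : Type*} [AddCommGroup E] [Module ℂ E]
    [UniformSpace E] [IsUniformAddGroup E] [ContinuousSMul ℂ E] [LocallyConvexSpace ℝ E]
    {F : Filter E} (hF : Cauchy F) {e : E} (he : ∀ l : E →L[ℂ] ℂ, Tendsto l F (𝓝 (l e))) :
    F ≤ 𝓝 e := by
  have := hF.1
  have : ContinuousConstSMul ℝ E :=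
    ⟨fun r => (continuous_const_smul (r : ℂ)).congr fun v => Complex.coe_smul r v⟩
  intro N hN
  have hN0 : (fun z => e + z) ⁻¹' N ∈ 𝓝 (0 : E) :=
    (continuous_const_add e).continuousAt.preimage_mem_nhds (by simpa using hN)
  obtain ⟨C, hC, hCc, hCN⟩ := exists_mem_nhds_isClosed_subset hN0
  obtain ⟨V, ⟨hV, hVconv⟩, hVC⟩ := (LocallyConvexSpace.convex_basis_zero ℝ E).mem_iff.1 hC
  have hVC' : closure V ⊆ C := closure_minimal hVC hCc
  obtain ⟨A, hA, hAV⟩ := (uniformity_eq_comap_nhds_zero E ▸ hF.2 :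
    F ×ˢ F ≤ comap (fun p : E × E => p.2 - p.1) (𝓝 0)) (preimage_mem_comap hV) |>
      mem_prod_same_iff.1
  refine mem_of_superset hA fun a ha => ?_
  -- For `b ∈ A` the vector `a - b` lies in `V`, and it tends weakly to `a - e`; closed convex sets
  -- are weakly closed.
  have hmem : a - e ∈ closure V := by
    by_contra hnot
    obtain ⟨l, u, hlt, hu⟩ := RCLike.geometric_hahn_banach_closed_point (𝕜 := ℂ)
      hVconv.closure isClosed_closure hnot
    have hlim : Tendsto (fun b => RCLike.re (l (a - b))) F (𝓝 (RCLike.re (l (a - e)))) := by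
      refine (RCLike.continuous_re.tendsto _).comp ?_
      simpa only [map_sub] using tendsto_const_nhds.sub (he l)
    refine absurd (le_of_tendsto hlim ?_) (not_le.2 hu)
    filter_upwards [hA] with b hb
    exact (hlt _ (subset_closure (hAV (Set.mk_mem_prod hb ha)))).le
  simpa using hCN (hVC' hmem)

/-- The series `∑ 2⁻ⁿ vₙ` is Cauchy if `vₙ → 0` in a locally convex space. -/
theorem cauchySeq_sum_geometric_smul {E : Type*} [AddCommGroup E] [Module ℝ E]
    [UniformSpace E] [IsUniformAddGroup E] [LocallyConvexSpace ℝ E] {v : ℕ → E}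
    (hv : Tendsto v atTop (𝓝 0)) :
    CauchySeq fun n => ∑ k ∈ Finset.range n, ((1 / 2 : ℝ) ^ k) • v k := by
  -- Since `n ≥ 1`, the weights add up to at most `1`, so the sum is a centre of mass shrunk towards
  -- `0`.
  have tail : ∀ {V : Set E}, Convex ℝ V → (0 : E) ∈ V → ∀ {w : ℕ → E} {n m : ℕ}, 1 ≤ n →
      (∀ k ≥ n, w k ∈ V) → ∑ k ∈ Finset.Ico n m, ((1 / 2 : ℝ) ^ k) • w k ∈ V := by
    intro V hV h0 w n m hn hw
    rcases le_or_gt m n with hmn | hnm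
    · simpa [Finset.Ico_eq_empty_of_le hmn] using h0
    have hpos : 0 < ∑ k ∈ Finset.Ico n m, (1 / 2 : ℝ) ^ k :=
      Finset.sum_pos (fun k _ => by positivity) (Finset.nonempty_Ico.2 hnm)
    have hle : ∑ k ∈ Finset.Ico n m, (1 / 2 : ℝ) ^ k ≤ 1 := by
      refine (geom_sum_Ico_le_of_lt_one (by norm_num) (by norm_num)).trans ?_
      have := pow_le_pow_of_le_one (a := (1 / 2 : ℝ)) (by norm_num) (by norm_num) hn
      rw [div_le_one (by norm_num)]
      linarith
    have hmem := hV.smul_mem_of_zero_mem h0 (hV.centerMass_mem (t := Finset.Ico n m)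
      (w := fun k => (1 / 2 : ℝ) ^ k) (z := w) (fun k _ => by positivity) hpos
      fun k hk => hw k (Finset.mem_Ico.1 hk).1) ⟨hpos.le, hle⟩
    rwa [Finset.centerMass, smul_inv_smul₀ hpos.ne'] at hmem
  refine cauchySeq_iff.2 fun U hU => ?_
  rw [uniformity_eq_comap_nhds_zero] at hU
  obtain ⟨W, hW, hWU⟩ := hU
  obtain ⟨V, ⟨hV, hVc⟩, hVW⟩ := (LocallyConvexSpace.convex_basis_zero ℝ E).mem_iff.1 hW
  -- `V` need not be symmetric, so both signs are controlled.
  have hneg : Tendsto (fun k => -v k) atTop (𝓝 0) := by simpa using hv.neg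
  obtain ⟨N, hN⟩ := ((hv.eventually hV).and (hneg.eventually hV)).exists_forall_of_atTop
  refine ⟨max N 1, fun k hk l hl => hWU (hVW ?_)⟩
  have hk1 := (le_max_right N 1).trans hk
  have hl1 := (le_max_right N 1).trans hl
  have hkN := (le_max_left N 1).trans hk
  have hlN := (le_max_left N 1).trans hl
  change ∑ i ∈ Finset.range l, _ - ∑ i ∈ Finset.range k, _ ∈ V
  rcases le_total k l with hkl | hlk
  · rw [← Finset.sum_Ico_eq_sub _ hkl]
    exact tail hVc (mem_of_mem_nhds hV) hk1 fun i hi => (hN i (hkN.trans hi)).1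
  · rw [← neg_sub, ← Finset.sum_Ico_eq_sub _ hlk, ← Finset.sum_neg_distrib]
    simp only [← smul_neg]
    exact tail hVc (mem_of_mem_nhds hV) hl1 fun i hi => (hN i (hlN.trans hi)).2

end LocallyConvex

/-! ### Free locally convex spaces and their completeness -/

namespace IsFreeLocallyConvexSpace

variable {X E : Type u} [TopologicalSpace X] [AddCommGroup E] [Module ℂ E]
  {ι : X → E}

section Topological

variable [TopologicalSpace E] [IsTopologicalAddGroup E] [ContinuousSMul ℂ E]
  [LocallyConvexSpace ℝ E] [T2Space E]

/-- Extend `ι` to an operator into the span; followed by the inclusion it is the identity, by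
uniqueness. -/
theorem span_range_eq_top (hι : IsFreeLocallyConvexSpace ι) :
    Submodule.span ℂ (Set.range ι) = ⊤ := by
  set S := Submodule.span ℂ (Set.range ι) with hS
  have hmem : ∀ x, ι x ∈ S := fun x => Submodule.subset_span ⟨x, rfl⟩
  have : LocallyConvexSpace ℝ S :=
    LocallyConvexSpace.induced (S.subtype.restrictScalars ℝ)
  obtain ⟨T, hT, -⟩ := hι.existsUnique_extension S (fun x => ⟨ι x, hmem x⟩)
    (hι.isEmbedding.continuous.subtype_mk _)
  have hid : S.subtypeL.comp T = ContinuousLinearMap.id ℂ E :=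
    (hι.existsUnique_extension E ι hι.isEmbedding.continuous).unique
      (fun x => by simp [hT]) fun x => rfl
  refine Submodule.eq_top_iff'.2 fun v => ?_
  have hv : ((T v : S) : E) = v := DFunLike.congr_fun hid v
  rw [← hv]
  exact (T v).2

theorem exists_linearCombination_eq (hι : IsFreeLocallyConvexSpace ι) (v : E) :
    ∃ c : X →₀ ℂ, Finsupp.linearCombination ℂ ι c = v :=
  (Finsupp.mem_span_range_iff_exists_finsupp.1
    (hι.span_range_eq_top ▸ Submodule.mem_top : v ∈ Submodule.span ℂ (Set.range ι)))

/-- The universal property covers only targets in universe `u`, so `Y` passes through `ULift`. -/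
theorem exists_normed_extension (hι : IsFreeLocallyConvexSpace ι) {Y : Type}
    [NormedAddCommGroup Y] [NormedSpace ℂ Y] (f : C(X, Y)) :
    ∃ T : E →L[ℂ] Y, ∀ x, T (ι x) = f x := by
  obtain ⟨T, hT, -⟩ := hι.existsUnique_extension (ULift.{u} Y) (fun x => ULift.up (f x))
    (continuous_uliftUp.comp f.continuous)
  exact ⟨(ContinuousLinearEquiv.ulift (R₁ := ℂ) (M₁ := Y) :
    ULift.{u} Y →L[ℂ] Y).comp T, fun x => congrArg ULift.down (hT x)⟩

theorem ext_continuousLinearMap (hι : IsFreeLocallyConvexSpace ι) {Y : Type*} [AddCommGroup Y]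
    [Module ℂ Y] [TopologicalSpace Y] {S T : E →L[ℂ] Y} (h : ∀ x, S (ι x) = T (ι x)) : S = T := by
  refine ContinuousLinearMap.coe_injective (LinearMap.ext_on_range hι.span_range_eq_top h)

/-- The continuous functional extending a continuous function. -/
noncomputable def lift (hι : IsFreeLocallyConvexSpace ι) (f : C(X, ℂ)) : E →L[ℂ] ℂ :=
  (hι.exists_normed_extension f).choose

@[simp]
theorem lift_apply (hι : IsFreeLocallyConvexSpace ι) (f : C(X, ℂ)) (x : X) :
    hι.lift f (ι x) = f x :=
  (hι.exists_normed_extension f).choose_spec x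

theorem lift_linearCombination (hι : IsFreeLocallyConvexSpace ι) (f : C(X, ℂ)) (c : X →₀ ℂ) :
    hι.lift f (Finsupp.linearCombination ℂ ι c) = c.sum fun x a => a * f x := by
  simp [Finsupp.linearCombination_apply, map_finsuppSum]

theorem lift_add (hι : IsFreeLocallyConvexSpace ι) (f g : C(X, ℂ)) :
    hι.lift (f + g) = hι.lift f + hι.lift g :=
  hι.ext_continuousLinearMap fun x => by simp

theorem lift_smul (hι : IsFreeLocallyConvexSpace ι) (a : ℂ) (f : C(X, ℂ)) :
    hι.lift (a • f) = a • hι.lift f :=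
  hι.ext_continuousLinearMap fun x => by simp

theorem lift_comp (hι : IsFreeLocallyConvexSpace ι) (l : E →L[ℂ] ℂ) :
    hι.lift ⟨fun x => l (ι x), l.continuous.comp hι.isEmbedding.continuous⟩ = l :=
  hι.ext_continuousLinearMap fun x => by simp

/-- The lift of the constant function `1` computes total mass. -/
theorem zeroMassSubspace_eq_ker (hι : IsFreeLocallyConvexSpace ι) :
    zeroMassSubspace ι = LinearMap.ker (hι.lift 1 : E →ₗ[ℂ] ℂ) := by
  have h : ∀ c : X →₀ ℂ, hι.lift 1 (Finsupp.linearCombination ℂ ι c) =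
      Finsupp.linearCombination ℂ (fun _ : X => (1 : ℂ)) c := fun c => by
    rw [lift_linearCombination, Finsupp.linearCombination_apply]
    simp
  ext v
  constructor
  · rintro ⟨c, hc, rfl⟩
    exact (h c).trans hc
  · intro hv
    obtain ⟨c, rfl⟩ := hι.exists_linearCombination_eq v
    exact ⟨c, (h c).symm.trans hv, rfl⟩

theorem isClosed_zeroMassSubspace (hι : IsFreeLocallyConvexSpace ι) :
    IsClosed (zeroMassSubspace ι : Set E) := by
  rw [hι.zeroMassSubspace_eq_ker]
  exact (hι.lift 1).isClosed_ker

theorem rank_le_aleph0 [Countable X] (hι : IsFreeLocallyConvexSpace ι) :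
    Module.rank ℂ E ≤ Cardinal.aleph0 := by
  rw [← rank_top ℂ E, ← hι.span_range_eq_top]
  exact (rank_span_le _).trans (Cardinal.mk_le_aleph0_iff.2 (Set.countable_range ι).to_subtype)

end Topological

section Uniform

variable [UniformSpace E] [IsUniformAddGroup E] [ContinuousSMul ℂ E]
  [LocallyConvexSpace ℝ E] [T2Space E] [T2Space X] [RegularSpace X] [Countable X]

theorem completeSpace_of_noNontrivialConvergentSeq (hι : IsFreeLocallyConvexSpace ι)
    (hX : NoNontrivialConvergentSeq X) : CompleteSpace E := by
  refine ⟨fun {F} hF => ?_⟩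
  have := hF.1
  have hlim : ∀ {Y : Type} [NormedAddCommGroup Y] [NormedSpace ℂ Y] [CompleteSpace Y]
      (T : E →L[ℂ] Y), ∃ y, Tendsto T F (𝓝 y) := fun T =>
    CompleteSpace.complete (hF.map T.uniformContinuous)
  choose p hp using fun f : C(X, ℂ) => hlim (hι.lift f)
  let φ : C(X, ℂ) →ₗ[ℂ] ℂ :=
    { toFun := p
      map_add' := fun f g => tendsto_nhds_unique (hp (f + g)) (by
        simpa [lift_add] using! (hp f).add (hp g))
      map_smul' := fun a f => tendsto_nhds_unique (hp (a • f)) (by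
        simpa [lift_smul] using! (hp f).const_smul a) }
  have hφ : IsSigmaAdditive φ := by
    refine isSigmaAdditive_of_forall_lp fun G => ?_
    obtain ⟨T, hT⟩ := hι.exists_normed_extension G
    obtain ⟨y, hy⟩ := hlim T
    -- By uniqueness of extensions, the lift of `l ∘ G` is `l ∘ T`, which tends to `l y`.
    refine ⟨y, fun l => tendsto_nhds_unique (hp _) ?_⟩
    rw [show hι.lift ((l : C(lp (fun _ : ℕ => ℂ) 1, ℂ)).comp G) = l.comp T from
      hι.ext_continuousLinearMap fun x => by simp [hT]]
    exact (l.continuous.tendsto y).comp hy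
  obtain ⟨s, c, hc⟩ := hφ.exists_finset_sum hX
  refine ⟨∑ x ∈ s, c x • ι x, hF.le_nhds_of_forall_tendsto fun l => ?_⟩
  have hl := hp ⟨fun x => l (ι x), l.continuous.comp hι.isEmbedding.continuous⟩
  rw [hι.lift_comp] at hl
  convert hl using 2
  exact (by simp : l (∑ x ∈ s, c x • ι x) = ∑ x ∈ s, c x * l (ι x)).trans (hc ⟨_, _⟩).symm

theorem noNontrivialConvergentSeq_of_completeSpace (hι : IsFreeLocallyConvexSpace ι)
    [CompleteSpace (zeroMassSubspace ι)] : NoNontrivialConvergentSeq X := by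
  intro s x hs
  by_contra! hcon
  have hv : Tendsto (fun n => ι (s n) - ι x) atTop (𝓝 0) := by
    simpa using ((hι.isEmbedding.continuous.tendsto x).comp hs).sub_const (ι x)
  have hmem : ∀ n, ∑ k ∈ Finset.range n, ((1 / 2 : ℝ) ^ k) • (ι (s k) - ι x) ∈
      (zeroMassSubspace ι : Set E) := by
    intro n
    rw [hι.zeroMassSubspace_eq_ker]
    simp [map_sum]
  obtain ⟨e, -, he⟩ := cauchySeq_tendsto_of_isComplete
    (completeSpace_coe_iff_isComplete.1 ‹CompleteSpace (zeroMassSubspace ι)›) hmem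
    (cauchySeq_sum_geometric_smul hv)
  obtain ⟨c, rfl⟩ := hι.exists_linearCombination_eq e
  classical
  -- Some `s n` must avoid both `x` and the support of the supposed sum: eventually the sequence
  -- leaves this finite set, yet it differs from `x` infinitely often.
  have hev : ∀ᶠ n in atTop, s n ∉ c.support.erase x :=
    hs.eventually ((c.support.erase x).finite_toSet.isClosed.isOpen_compl.mem_nhds (by simp))
  obtain ⟨N, hN⟩ := hev.exists_forall_of_atTop
  obtain ⟨n, hn, hnx⟩ : ∃ n ≥ N, s n ≠ x := by
    by_contra! h
    obtain ⟨n, hn, hne⟩ := hcon N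
    exact hne ((h n hn).trans (h N le_rfl).symm)
  have hns : s n ∉ insert x c.support := by
    have := hN n hn
    simp only [Finset.mem_erase, Finset.mem_insert] at this ⊢
    tauto
  obtain ⟨f, hf1, hf0, hfnn⟩ := exists_continuousMap_eq_one_eq_zero
    (insert x c.support).finite_toSet.isClosed (x := s n) (by simpa using hns)
  have hfx : f x = 0 := hf0 x (by simp)
  have hlim : Tendsto (fun m => ∑ k ∈ Finset.range m, (1 / 2 : ℝ) ^ k * (f (s k)).re) atTop
      (𝓝 0) := by
    have h := (Complex.continuous_re.tendsto _).comp (((hι.lift f).continuous.tendsto _).comp he)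
    have h0 : hι.lift f (Finsupp.linearCombination ℂ ι c) = 0 := by
      rw [hι.lift_linearCombination]
      exact Finset.sum_eq_zero fun y hy => by simp [hf0 y (by simp [Finsupp.mem_support_iff.1 hy])]
    rw [h0, Complex.zero_re] at h
    refine h.congr fun m => ?_
    simp only [Function.comp_apply, map_sum, ContinuousLinearMap.map_smul_of_tower, map_sub,
      hι.lift_apply, hfx, sub_zero, Complex.re_sum, Complex.smul_re, smul_eq_mul]
  -- All terms are nonnegative and the `n`-th one is `2⁻ⁿ`, so the partial sums cannot tend to `0`.
  refine absurd (ge_of_tendsto hlim (b := (1 / 2 : ℝ) ^ n) ?_) (not_le.2 (by positivity))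
  filter_upwards [eventually_gt_atTop n] with m hm
  refine le_trans ?_ (Finset.single_le_sum (fun k _ => mul_nonneg (by positivity) (hfnn (s k)))
    (Finset.mem_range.2 hm))
  simp [hf1]

end Uniform

end IsFreeLocallyConvexSpace

theorem proposition3 (X : Type u) [TopologicalSpace X] [T2Space X] [RegularSpace X] [Countable X]
    (E : Type u) [AddCommGroup E] [Module ℂ E] [UniformSpace E] [IsUniformAddGroup E]
    [ContinuousSMul ℂ E] [LocallyConvexSpace ℝ E] [T2Space E]
    (ι : X → E) (hι : IsFreeLocallyConvexSpace ι) :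
    (Module.rank ℂ E ≤ Cardinal.aleph0 ∧ Module.rank ℂ (zeroMassSubspace ι) ≤ Cardinal.aleph0) ∧
    (CompleteSpace E ↔ NoNontrivialConvergentSeq X) ∧
    (CompleteSpace (zeroMassSubspace ι) ↔ NoNontrivialConvergentSeq X) := by
  have hsub : CompleteSpace E → CompleteSpace (zeroMassSubspace ι) := fun _ =>
    hι.isClosed_zeroMassSubspace.completeSpace_coe
  have hseq : CompleteSpace (zeroMassSubspace ι) → NoNontrivialConvergentSeq X := fun _ =>
    hι.noNontrivialConvergentSeq_of_completeSpace
  have hcomp := hι.completeSpace_of_noNontrivialConvergentSeq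
  exact ⟨⟨hι.rank_le_aleph0, (Submodule.rank_le _).trans hι.rank_le_aleph0⟩,
    ⟨fun h => hseq (hsub h), hcomp⟩, ⟨hseq, fun h => hsub (hcomp h)⟩⟩
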